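/- Write points of $\mathbb{H}^n$ as $q=(q_0,\dots,q_{n-1})$ with $q_l=x_{4l}+\mathbf{i}x_{4l+1}+\mathbf{j}x_{4l+2}+\mathbf{k}x_{4l+3}$, and for $0\le l<n$ let $$\begin{pmatrix}\nabla_{(2l)0}&\nabla_{(2l)1}\\ \nabla_{(2l+1)0}&\nabla_{(2l+1)1}\end{pmatrix}=\begin{pmatrix}\partial_{x_{4l}}+\mathbf{i}\partial_{x_{4l+1}}&-\partial_{x_{4l+2}}-\mathbf{i}\partial_{x_{4l+3}}\\ \partial_{x_{4l+2}}-\mathbf{i}\partial_{x_{4l+3}}&\partial_{x_{4l}}-\mathbf{i}\partial_{x_{4l+1}}\end{pmatrix},\qquad \triangle_{ij}u=\tfrac12\left(\nabla_{i0}\nabla_{j1}u-\nabla_{i1}\nabla_{j0}u\right)\quad(0\le i,j<2n).$$ For real-valued $C^2$ functions $f_1,\dots,f_n$ on $\mathbb{H}^n$ put $$\triangle_n(f_1,\dots,f_n)=\sum_{i_1,j_1,\dots,i_n,j_n=0}^{2n-1}\delta^{i_1j_1\dots i_nj_n}_{01\dots(2n-1)}\,\triangle_{i_1j_1}f_1\cdots\triangle_{i_nj_n}f_n,$$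 where $\delta^{i_1j_1\dots i_nj_n}_{01\dots(2n-1)}$ is the sign of the permutation from $(i_1,j_1,\dots,i_n,j_n)$ to $(0,1,\dots,2n-1)$ if it is one and $0$ otherwise, and $$\triangle_n u=\sum_{i_1,j_1,\dots,i_n,j_n=0}^{2n-1}\delta^{i_1j_1\dots i_nj_n}_{01\dots(2n-1)}\,\nabla_{i_10}\nabla_{j_11}u\cdots\nabla_{i_n0}\nabla_{j_n1}u .$$ The quaternionic Hessian of a real-valued $C^2$ function $u$ is the hyperhermitian matrix $H(u)$ with entry $$H(u)_{lk}=\frac{\partial^2u}{\partial\bar q_l\,\partial q_k}=\left(\partial_{x_{4l}}+\mathbf{i}\partial_{x_{4l+1}}+\mathbf{j}\partial_{x_{4l+2}}+\mathbf{k}\partial_{x_{4l+3}}\right)\left(\partial_{x_{4k}}-\mathbf{i}\partial_{x_{4k+1}}-\mathbf{j}\partial_{x_{4k+2}}-\mathbf{k}\partial_{x_{4k+3}}\right)u$$ in row $l$ and column $k$. Let $\det$ denote the Moore determinant of hyperhermitian matrices, $\det A=\sum_\sigma\operatorname{sgn}(\sigma)\prod a_{i_1i_2}a_{i_2i_3}\cdots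 a_{i_ri_1}$, the product being over the cycles $(i_1\,i_2\dots i_r)$ of $\sigma$ (fixed points included), each written with its smallest element first, and the cycles ordered so that their smallest elements decrease from left to right; it is a real number. Let the mixed discriminant $\det(A_1,\dots,A_n)$ be the coefficient of $\lambda_1\cdots\lambda_n$ in the real polynomial $\det(\lambda_1A_1+\dots+\lambda_nA_n)$, divided by $n!$, and write $\det(f_1,\dots,f_n)=\det(H(f_1),\dots,H(f_n))$. **Theorem.** For all real-valued $C^2$ functions $f_1,\dots,f_n$ on $\mathbb{H}^n$, at every point of $\mathbb{H}^n$, $$\triangle_n(f_1,\dots,f_n)=n!\,\det(f_1,\dots,f_n).$$ Consequently $\triangle_n$ coincides, up to the constant factor $n!$, with the quaternionic Monge–Ampère operator $u\mapsto\det H(u)$: for every real-valued $C^2$ function $u$ on $\mathbb{H}^n$, $$\triangle_n(u,\dots,u)=\triangle_nu=n!\,\det H(u).$$ -/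

import Mathlib

namespace QuatMA

noncomputable section

/-! ### First-order operators on `ℍⁿ`

A point of `ℍⁿ` is `q : Fin n → Quaternion ℝ`, and its real coordinates are given by
`q l = x_{4l} + x_{4l+1} i + x_{4l+2} j + x_{4l+3} k`. -/

/-- The real basis `1, i, j, k` of the quaternions. -/
def unit (a : Fin 4) : Quaternion ℝ :=
  match a with
  | 0 => ⟨1, 0, 0, 0⟩
  | 1 => ⟨0, 1, 0, 0⟩
  | 2 => ⟨0, 0, 1, 0⟩
  | 3 => ⟨0, 0, 0, 1⟩

/-- The real partial derivative `∂F/∂x_{4l+a}` of a function on `ℍⁿ`. -/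
def partialX {n : ℕ} {E : Type*} [NormedAddCommGroup E] [NormedSpace ℝ E]
    (l : Fin n) (a : Fin 4) (F : (Fin n → Quaternion ℝ) → E) (q : Fin n → Quaternion ℝ) : E :=
  fderiv ℝ F q (Pi.single l (unit a))

/-- The operators `∇_{jα}`. The row index `j = 2l + s ∈ 0, …, 2n-1` is written as the
pair `(l, s) : Fin n × Fin 2`. -/
def nabla {n : ℕ} (j : Fin n × Fin 2) (α : Fin 2) (F : (Fin n → Quaternion ℝ) → ℂ)
    (q : Fin n → Quaternion ℝ) : ℂ :=
  match j.2, α with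
  | 0, 0 => partialX j.1 0 F q + Complex.I * partialX j.1 1 F q
  | 0, 1 => -partialX j.1 2 F q - Complex.I * partialX j.1 3 F q
  | 1, 0 => partialX j.1 2 F q - Complex.I * partialX j.1 3 F q
  | 1, 1 => partialX j.1 0 F q - Complex.I * partialX j.1 1 F q

/-- `∇_{i0} ∇_{j1} u` for a real-valued function `u`. -/
def nabla2 {n : ℕ} (i j : Fin n × Fin 2) (u : (Fin n → Quaternion ℝ) → ℝ)
    (q : Fin n → Quaternion ℝ) : ℂ :=
  nabla i 0 (nabla j 1 (fun p => (u p : ℂ))) q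

/-- `△_{ij} u = (∇_{i0} ∇_{j1} u - ∇_{i1} ∇_{j0} u) / 2`, the coefficient of `ω^i ∧ ω^j` in
the Baston operator `△ u = ∑ △_{ij} u ω^i ∧ ω^j`. -/
def triangle {n : ℕ} (i j : Fin n × Fin 2) (u : (Fin n → Quaternion ℝ) → ℝ)
    (q : Fin n → Quaternion ℝ) : ℂ :=
  (nabla i 0 (nabla j 1 (fun p => (u p : ℂ))) q
    - nabla i 1 (nabla j 0 (fun p => (u p : ℂ))) q) / 2

open Classical in
/-- The symbol `δ^{i_1 j_1 … i_n j_n}_{0 1 … (2n-1)}`. The sequence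
`(i_1, j_1, …, i_n, j_n)` is the function `w` with `w (m, 0)` and `w (m, 1)` the `m`-th pair;
positions and values are both identified with `0, …, 2n-1` by `(l, s) ↦ 2l + s`. The value is
the sign of the permutation if `w` is one, and `0` otherwise. -/
def delta {n : ℕ} (w : Fin n × Fin 2 → Fin n × Fin 2) : ℂ :=
  if h : Function.Bijective w then
    (((Equiv.Perm.sign (Equiv.ofBijective w h) : ℤˣ) : ℤ) : ℂ)
  else 0

/-- `△_n(f_1, …, f_n)`: the coefficient of `△ f_1 ∧ … ∧ △ f_n` with respect to
`ω^0 ∧ ω^1 ∧ … ∧ ω^{2n-1}`, that is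
`∑ δ^{i_1 j_1 … i_n j_n}_{0 1 … (2n-1)} △_{i_1 j_1} f_1 ⋯ △_{i_n j_n} f_n`. -/
def bastonMixed {n : ℕ} (f : Fin n → (Fin n → Quaternion ℝ) → ℝ)
    (q : Fin n → Quaternion ℝ) : ℂ :=
  ∑ w : Fin n × Fin 2 → Fin n × Fin 2,
    delta w * ∏ m : Fin n, triangle (w (m, 0)) (w (m, 1)) (f m) q

/-- The operator `△_n u =
∑ δ^{i_1 j_1 … i_n j_n}_{0 1 … (2n-1)} ∇_{i_1 0} ∇_{j_1 1} u ⋯ ∇_{i_n 0} ∇_{j_n 1} u`. -/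
def baston {n : ℕ} (u : (Fin n → Quaternion ℝ) → ℝ) (q : Fin n → Quaternion ℝ) : ℂ :=
  ∑ w : Fin n × Fin 2 → Fin n × Fin 2,
    delta w * ∏ m : Fin n, nabla2 (w (m, 0)) (w (m, 1)) u q

/-! ### The quaternionic Hessian -/

/-- `∂/∂q̄_l = ∂_{x_{4l}} + i ∂_{x_{4l+1}} + j ∂_{x_{4l+2}} + k ∂_{x_{4l+3}}`. -/
def dqBar {n : ℕ} (l : Fin n) (F : (Fin n → Quaternion ℝ) → Quaternion ℝ)
    (q : Fin n → Quaternion ℝ) : Quaternion ℝ :=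
  ∑ a : Fin 4, unit a * partialX l a F q

/-- `∂/∂q_k = ∂_{x_{4k}} - i ∂_{x_{4k+1}} - j ∂_{x_{4k+2}} - k ∂_{x_{4k+3}}`. -/
def dq {n : ℕ} (k : Fin n) (F : (Fin n → Quaternion ℝ) → Quaternion ℝ)
    (q : Fin n → Quaternion ℝ) : Quaternion ℝ :=
  ∑ a : Fin 4, star (unit a) * partialX k a F q

/-- The quaternionic Hessian of a real-valued function: the hyperhermitian matrix whose entry
in row `l` and column `k` is `∂²u / ∂q̄_l ∂q_k`. -/
def hessian {n : ℕ} (u : (Fin n → Quaternion ℝ) → ℝ) (q : Fin n → Quaternion ℝ) :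
    Matrix (Fin n) (Fin n) (Quaternion ℝ) :=
  Matrix.of fun l k => dqBar l (dq k (fun p => (u p : Quaternion ℝ))) q

/-! ### The Moore determinant and the mixed discriminant -/

/-- The product `a_{i,σ(i)} a_{σ(i),σ²(i)} ⋯ a_{σ⁻¹(i),i}` along the cycle of `σ` through `i`,
beginning at `i`. -/
def cycleProd {R : Type*} [CommRing R] {n : ℕ} (A : Matrix (Fin n) (Fin n) (Quaternion R))
    (σ : Equiv.Perm (Fin n)) (i : Fin n) : Quaternion R :=
  ((List.range (Function.minimalPeriod σ i)).map
    fun k => A ((σ ^ k) i) ((σ ^ (k + 1)) i)).prod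

open Classical in
/-- The term of a permutation `σ` in Moore's determinant: each cycle (fixed points included)
begins with its smallest element, and the cycles are ordered so that these smallest elements
decrease from left to right. -/
def mooreTerm {R : Type*} [CommRing R] {n : ℕ} (A : Matrix (Fin n) (Fin n) (Quaternion R))
    (σ : Equiv.Perm (Fin n)) : Quaternion R :=
  (((List.finRange n).reverse.filter fun i => decide (∀ j, σ.SameCycle i j → i ≤ j)).map
    fun i => cycleProd A σ i).prod

/-- Moore's sum `∑_σ sgn(σ) ∏_{cycles} a_{i_1 i_2} a_{i_2 i_3} ⋯ a_{i_r i_1}`. -/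
def mooreSum {R : Type*} [CommRing R] {n : ℕ} (A : Matrix (Fin n) (Fin n) (Quaternion R)) :
    Quaternion R :=
  ∑ σ : Equiv.Perm (Fin n), ((Equiv.Perm.sign σ : ℤˣ) : ℤ) • mooreTerm A σ

/-- The Moore determinant of a hyperhermitian matrix. It is a scalar: for a hyperhermitian
matrix the three imaginary components of Moore's sum vanish. -/
def mooreDet {R : Type*} [CommRing R] {n : ℕ} (A : Matrix (Fin n) (Fin n) (Quaternion R)) : R :=
  (mooreSum A).re

/-- A real quaternion as a quaternion with coefficients in the polynomial ring
`ℝ[λ_1, …, λ_n]` (constant polynomials). -/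
def constPoly {n : ℕ} (x : Quaternion ℝ) : Quaternion (MvPolynomial (Fin n) ℝ) :=
  ⟨MvPolynomial.C x.re, MvPolynomial.C x.imI, MvPolynomial.C x.imJ, MvPolynomial.C x.imK⟩

/-- The polynomial `det(λ_1 A_1 + ⋯ + λ_n A_n)` in the real variables `λ_1, …, λ_n`. -/
def detPoly {n : ℕ} (A : Fin n → Matrix (Fin n) (Fin n) (Quaternion ℝ)) :
    MvPolynomial (Fin n) ℝ :=
  mooreDet (∑ m : Fin n,
    (MvPolynomial.X m : MvPolynomial (Fin n) ℝ) • (A m).map (constPoly (n := n)))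

/-- The mixed discriminant `det(A_1, …, A_n)`: the coefficient of `λ_1 ⋯ λ_n` in
`det(λ_1 A_1 + ⋯ + λ_n A_n)`, divided by `n!`. -/
def mixedDiscriminant {n : ℕ} (A : Fin n → Matrix (Fin n) (Fin n) (Quaternion ℝ)) : ℝ :=
  MvPolynomial.coeff (∑ m : Fin n, Finsupp.single m 1) (detPoly A) / (n.factorial : ℝ)

end

end QuatMA

namespace QuatMA

open Equiv Equiv.Perm Finset

noncomputable section

/-! ### The complex representation of quaternions -/

/-! Both sides are Pfaffians. Represent quaternions by 2×2 matrices over a commutative ring `C`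
containing a square root of -1. Twisting the columns of the resulting 2n×2n matrix by the
quaternionic structure turns a hyperhermitian matrix into a skew form (`quatPair_skew`), and for the
Hessian this form is `2 * triangle` (`quatPair_hessian`). The heart is `pfSum_quatPair`: the
Pfaffian-like sum of this form over all permutations of `Fin n × Fin 2` is `2 ^ n * n!` times the
Moore determinant.

On the Moore side, a permutation can be averaged with the one obtained by inverting a cycle. This
replaces a cycle product x by its conjugate, and x + x̄ is real, so every cycle product may be
replaced by its (0,0) entry. Expanding these entries gives a sum over pairs (σ, s) with s = 0 at
cycle minima. On the Pfaffian side, a skew term depends only on the perfect matching {w (m, 0), w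
(m, 1)}. Superposing it on the standard matching gives closed loops; following each loop in the
direction that leaves its least index on sheet 0 recovers exactly one such (σ, s).

Since this holds over any commutative ring `R` mapped to a domain `C` of characteristic zero, it
applies to λ_1 A_1 + ⋯ + λ_n A_n over a polynomial ring; the coefficient of λ_1⋯λ_n gives the mixed
statement (`pfSum_mixed`). The version with `nabla2` follows because `triangle` is its
antisymmetrization, to which a Pfaffian sum is blind up to `2 ^ n`. -/

/-- The representation of quaternions by two by two matrices, over a commutative ring `C` that
contains a square root `I` of `-1`. -/
def quatRep {R C : Type*} [CommRing R] [CommRing C] (φ : R →+* C) (I : C) (hI : I * I = -1) :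
    Quaternion R →+* Matrix (Fin 2) (Fin 2) C where
  toFun x := !![φ x.re + I * φ x.imI, -φ x.imJ - I * φ x.imK;
    φ x.imJ - I * φ x.imK, φ x.re - I * φ x.imI]
  map_one' := by
    ext i j
    fin_cases i <;> fin_cases j <;>
      simp [Quaternion.re_one, Quaternion.imI_one, Quaternion.imJ_one, Quaternion.imK_one]
  map_zero' := by
    ext i j
    fin_cases i <;> fin_cases j <;>
      simp [Quaternion.re_zero, Quaternion.imI_zero, Quaternion.imJ_zero, Quaternion.imK_zero]
  map_add' x y := by
    ext i j; fin_cases i <;> fin_cases j <;> simp <;> ring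
  map_mul' x y := by
    ext i j
    fin_cases i <;> fin_cases j <;> simp [Matrix.mul_apply]
    · linear_combination
        (-(φ x.imI * φ y.imI) - φ x.imK * φ y.imK) * hI
    · linear_combination
        (φ x.imI * φ y.imK - φ x.imK * φ y.imI) * hI
    · linear_combination
        (-(φ x.imI * φ y.imK) + φ x.imK * φ y.imI) * hI
    · linear_combination
        (-(φ x.imI * φ y.imI) - φ x.imK * φ y.imK) * hI

section quatRep

variable {R C : Type*} [CommRing R] [CommRing C] (φ : R →+* C) (I : C) (hI : I * I = -1)

lemma quatRep_apply (x : Quaternion R) :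
    quatRep φ I hI x = !![φ x.re + I * φ x.imI, -φ x.imJ - I * φ x.imK;
      φ x.imJ - I * φ x.imK, φ x.re - I * φ x.imI] := rfl

/-- x + x̄ is real, hence represented by a scalar matrix. Splitting that scalar into two (0,0)
entries lets x and x̄ be replaced separately. -/
lemma quatRep_add_star (x : Quaternion R) :
    quatRep φ I hI x + quatRep φ I hI (star x) =
      Matrix.scalar (Fin 2) (quatRep φ I hI x 0 0) +
        Matrix.scalar (Fin 2) (quatRep φ I hI (star x) 0 0) := by
  ext i j
  fin_cases i <;> fin_cases j <;> (simp [quatRep_apply]; try ring)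

lemma quatRep_trace (x : Quaternion R) :
    quatRep φ I hI x 0 0 + quatRep φ I hI x 1 1 = 2 * φ x.re := by
  simp [quatRep_apply]; ring

/-- The sign `(-1)^s` of an index `s : Fin 2`. -/
def altSign (C : Type*) [CommRing C] (s : Fin 2) : C := (-1) ^ (s : ℕ)

/-- Conjugation becomes the adjugate of a 2×2 matrix; this is the source of the skew symmetry of
`quatPair`. -/
lemma quatRep_star (x : Quaternion R) (s t : Fin 2) :
    quatRep φ I hI (star x) s t =
      altSign C s * altSign C t * quatRep φ I hI x (1 - t) (1 - s) := by
  fin_cases s <;> fin_cases t <;> simp [quatRep_apply, altSign] <;> ring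

end quatRep

/-! ### Inverting one cycle of a permutation -/

section invCycle

variable {α : Type*} [Fintype α] [DecidableEq α]

/-- The permutation obtained from `σ` by inverting its cycle through `i`. -/
def invCycle (σ : Perm α) (i : α) : Perm α := σ * (σ.cycleOf i)⁻¹ * (σ.cycleOf i)⁻¹

lemma invCycle_apply_of_sameCycle {σ : Perm α} {i x : α} (h : σ.SameCycle i x) :
    invCycle σ i x = σ⁻¹ x := by
  have h1 : σ⁻¹.SameCycle i x := sameCycle_inv.2 h
  have h2 : σ⁻¹.SameCycle i (σ⁻¹ x) := h1.apply_right
  rw [invCycle, cycleOf_inv, mul_apply, mul_apply, h1.cycleOf_apply, h2.cycleOf_apply]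
  simp

lemma invCycle_apply_of_not_sameCycle {σ : Perm α} {i x : α} (h : ¬ σ.SameCycle i x) :
    invCycle σ i x = σ x := by
  have h1 : ¬ σ⁻¹.SameCycle i x := fun h' => h (sameCycle_inv.1 h')
  rw [invCycle, cycleOf_inv, mul_apply, mul_apply, cycleOf_apply_of_not_sameCycle h1,
    cycleOf_apply_of_not_sameCycle h1]

lemma sign_invCycle (σ : Perm α) (i : α) : sign (invCycle σ i) = sign σ := by
  rw [invCycle, Perm.sign_mul, Perm.sign_mul, mul_assoc, Int.units_mul_self, mul_one]

lemma invCycle_pow_of_sameCycle {σ : Perm α} {i x : α} (h : σ.SameCycle i x) (k : ℕ) :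
    (invCycle σ i ^ k) x = (σ⁻¹ ^ k) x := by
  induction k with
  | zero => rfl
  | succ k ih =>
    rw [pow_succ', pow_succ', mul_apply, mul_apply, ih, invCycle_apply_of_sameCycle]
    exact sameCycle_inv.1 (sameCycle_pow_right.2 (sameCycle_inv.2 h))

lemma invCycle_pow_of_not_sameCycle {σ : Perm α} {i x : α} (h : ¬ σ.SameCycle i x) (k : ℕ) :
    (invCycle σ i ^ k) x = (σ ^ k) x := by
  induction k with
  | zero => rfl
  | succ k ih =>
    rw [pow_succ', pow_succ', mul_apply, mul_apply, ih, invCycle_apply_of_not_sameCycle]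
    exact fun h' => h (sameCycle_pow_right.1 h')

lemma SameCycle.invCycle {σ : Perm α} {x y : α} (h : σ.SameCycle x y) (i : α) :
    (invCycle σ i).SameCycle x y := by
  by_cases hx : σ.SameCycle i x
  · obtain ⟨k, -, hk⟩ := (sameCycle_inv.2 h).exists_pow_eq'
    exact ⟨k, by rw [zpow_natCast, invCycle_pow_of_sameCycle hx, hk]⟩
  · obtain ⟨k, -, hk⟩ := h.exists_pow_eq'
    exact ⟨k, by rw [zpow_natCast, invCycle_pow_of_not_sameCycle hx, hk]⟩

lemma invCycle_invCycle (σ : Perm α) (i : α) : invCycle (invCycle σ i) i = σ := by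
  ext x
  by_cases hx : σ.SameCycle i x
  · rw [invCycle_apply_of_sameCycle (SameCycle.invCycle hx i), inv_eq_iff_eq,
      invCycle_apply_of_sameCycle hx.apply_right]
    simp
  · have : ¬ (invCycle σ i).SameCycle i x := by
      rintro ⟨k, hk⟩
      have h : (invCycle σ i).SameCycle i x := ⟨k, hk⟩
      obtain ⟨m, -, hm⟩ := h.exists_pow_eq'
      rw [invCycle_pow_of_sameCycle (SameCycle.refl σ i)] at hm
      exact hx (sameCycle_inv.1 ⟨m, by rw [zpow_natCast, hm]⟩)
    rw [invCycle_apply_of_not_sameCycle this, invCycle_apply_of_not_sameCycle hx]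

lemma sameCycle_invCycle_iff {σ : Perm α} {i x y : α} :
    (invCycle σ i).SameCycle x y ↔ σ.SameCycle x y :=
  ⟨fun h => by simpa only [invCycle_invCycle] using SameCycle.invCycle h i,
    fun h => SameCycle.invCycle h i⟩

/-- `σ ↦ invCycle σ i` is an involution of the set of all permutations. -/
def invCycleEquiv (i : α) : Perm (Perm α) where
  toFun σ := invCycle σ i
  invFun σ := invCycle σ i
  left_inv σ := invCycle_invCycle σ i
  right_inv σ := invCycle_invCycle σ i

end invCycle

lemma pow_minimalPeriod_apply {α : Type*} (σ : Perm α) (i : α) :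
    (σ ^ Function.minimalPeriod σ i) i = i := by
  rw [← iterate_eq_pow]
  exact Function.isPeriodicPt_minimalPeriod σ i

/-! ### Cycle products -/

section cycleProd

variable {R : Type*} [CommRing R] {n : ℕ} (A : Matrix (Fin n) (Fin n) (Quaternion R))

lemma cycleProd_invCycle_of_not_sameCycle {σ : Perm (Fin n)} {i j : Fin n}
    (h : ¬ σ.SameCycle i j) : cycleProd A (invCycle σ i) j = cycleProd A σ j := by
  have hp : Function.minimalPeriod (invCycle σ i) j = Function.minimalPeriod σ j := by
    rw [Function.minimalPeriod_eq_minimalPeriod_iff]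
    intro k
    simp only [Function.IsPeriodicPt, Function.IsFixedPt, iterate_eq_pow,
      invCycle_pow_of_not_sameCycle h]
  simp only [cycleProd, hp, invCycle_pow_of_not_sameCycle h]

lemma star_list_prod {M : Type*} [Monoid M] [StarMul M] (l : List M) :
    star l.prod = (l.map star).reverse.prod := by
  induction l with
  | nil => simp
  | cons a l ih => simp [ih]

/-- Traversing a cycle backwards reverses the order of the factors and transposes each of them; for
hyperhermitian `A` that is what `star` does to the product. -/
lemma cycleProd_invCycle_self (hA : ∀ l k, star (A l k) = A k l) (σ : Perm (Fin n))
    (i : Fin n) : cycleProd A (invCycle σ i) i = star (cycleProd A σ i) := by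
  have hr := SameCycle.refl σ i
  have hp : Function.minimalPeriod (invCycle σ i) i = Function.minimalPeriod σ i := by
    rw [Function.minimalPeriod_eq_minimalPeriod_iff]
    intro k
    simp only [Function.IsPeriodicPt, Function.IsFixedPt, iterate_eq_pow,
      invCycle_pow_of_sameCycle hr]
    rw [inv_pow, inv_eq_iff_eq, eq_comm]
  have hs : ∀ a b, a + b = Function.minimalPeriod σ i → (σ⁻¹ ^ a) i = (σ ^ b) i := by
    intro a b hab
    rw [inv_pow, inv_eq_iff_eq, ← mul_apply, ← pow_add, hab, pow_minimalPeriod_apply]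
  rw [cycleProd, cycleProd, star_list_prod, hp]
  congr 1
  apply List.ext_getElem
  · simp
  · intro k h1 h2
    have hk : k < Function.minimalPeriod σ i := by simpa using h1
    simp only [List.getElem_map, List.getElem_range, List.getElem_reverse, List.length_map,
      List.length_range, hA, invCycle_pow_of_sameCycle hr]
    rw [hs k (Function.minimalPeriod σ i - 1 - k + 1) (by omega),
      hs (k + 1) (Function.minimalPeriod σ i - 1 - k) (by omega)]

end cycleProd

/-! ### The Moore determinant as a sum of products of scalars -/

/-- The factor at `i` occurs exactly once, so the sum of two products that agree elsewhere depends
only on the sum of their factors at `i`, even without commutativity. -/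
lemma list_prod_map_add_eq {ι S : Type*} [DecidableEq ι] [Ring S] {f g f' g' : ι → S} {i : ι}
    (hfg : ∀ j, j ≠ i → f j = g j) (hff' : ∀ j, j ≠ i → f j = f' j)
    (hfg' : ∀ j, j ≠ i → f j = g' j) (hi : f i + g i = f' i + g' i)
    {l : List ι} (hl : l.Nodup) (hil : i ∈ l) :
    (l.map f).prod + (l.map g).prod = (l.map f').prod + (l.map g').prod := by
  induction l with
  | nil => simp at hil
  | cons a l ih =>
    rw [List.nodup_cons] at hl
    by_cases ha : a = i
    · subst ha
      have key : ∀ h : ι → S, (∀ j, j ≠ a → f j = h j) → l.map h = l.map f := fun h hh =>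
        List.map_congr_left fun j hj => (hh j (by rintro rfl; exact hl.1 hj)).symm
      simp only [List.map_cons, List.prod_cons, key g hfg, key f' hff', key g' hfg']
      rw [← add_mul, hi, add_mul]
    · have hil' : i ∈ l := by
        rcases List.mem_cons.1 hil with h | h
        · exact absurd h.symm ha
        · exact h
      simp only [List.map_cons, List.prod_cons, ← hfg a ha, ← hff' a ha, ← hfg' a ha]
      rw [← mul_add, ih hl.2 hil', mul_add]

open Classical in
/-- The smallest elements of the cycles of `σ`, in decreasing order. -/
def cycleMins {n : ℕ} (σ : Perm (Fin n)) : List (Fin n) :=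
  (List.finRange n).reverse.filter fun i => decide (∀ j, σ.SameCycle i j → i ≤ j)

lemma mem_cycleMins {n : ℕ} {σ : Perm (Fin n)} {i : Fin n} :
    i ∈ cycleMins σ ↔ ∀ j, σ.SameCycle i j → i ≤ j := by
  simp [cycleMins]

lemma nodup_cycleMins {n : ℕ} (σ : Perm (Fin n)) : (cycleMins σ).Nodup :=
  (List.nodup_reverse.2 (List.nodup_finRange n)).filter _

lemma cycleMins_invCycle {n : ℕ} (σ : Perm (Fin n)) (i : Fin n) :
    cycleMins (invCycle σ i) = cycleMins σ := by
  simp only [cycleMins, sameCycle_invCycle_iff]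

lemma mooreTerm_eq {R : Type*} [CommRing R] {n : ℕ} (A : Matrix (Fin n) (Fin n) (Quaternion R))
    (σ : Perm (Fin n)) : mooreTerm A σ = ((cycleMins σ).map fun i => cycleProd A σ i).prod := rfl

section moore

variable {R C : Type*} [CommRing R] [CommRing C] (φ : R →+* C) (I : C) (hI : I * I = -1)
  {n : ℕ} (A : Matrix (Fin n) (Fin n) (Quaternion R))

/-- The factor of `σ` at `i` in Moore's determinant, where for the indices in `K` the matrix
is replaced by the scalar matrix of its first entry. -/
def mooreFactor (K : Finset (Fin n)) (σ : Perm (Fin n)) (i : Fin n) :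
    Matrix (Fin 2) (Fin 2) C :=
  if i ∈ K then Matrix.scalar (Fin 2) (quatRep φ I hI (cycleProd A σ i) 0 0)
  else quatRep φ I hI (cycleProd A σ i)

lemma mooreFactor_empty (σ : Perm (Fin n)) :
    mooreFactor φ I hI A ∅ σ = fun i => quatRep φ I hI (cycleProd A σ i) := by
  funext i; simp [mooreFactor]

lemma mooreFactor_univ (σ : Perm (Fin n)) :
    mooreFactor φ I hI A univ σ =
      fun i => Matrix.scalar (Fin 2) (quatRep φ I hI (cycleProd A σ i) 0 0) := by
  funext i; simp [mooreFactor]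

lemma mooreFactor_sum_insert [IsDomain C] [CharZero C] (hA : ∀ l k, star (A l k) = A k l)
    (K : Finset (Fin n)) (i : Fin n) (hi : i ∉ K) :
    ∑ σ : Perm (Fin n), ((sign σ : ℤˣ) : ℤ) •
        ((cycleMins σ).map (mooreFactor φ I hI A (insert i K) σ)).prod =
      ∑ σ : Perm (Fin n), ((sign σ : ℤˣ) : ℤ) •
        ((cycleMins σ).map (mooreFactor φ I hI A K σ)).prod := by
  -- Reindexing one of two copies of the sum by the sign-preserving involution `invCycle · i` pairs
  -- each σ with its partner; the factor 2 is cancelled afterwards.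
  have double : ∀ F : Perm (Fin n) → Matrix (Fin 2) (Fin 2) C,
      (2 : C) • ∑ σ, ((sign σ : ℤˣ) : ℤ) • F σ =
        ∑ σ, ((sign σ : ℤˣ) : ℤ) • (F σ + F (invCycle σ i)) := by
    intro F
    simp only [smul_add, sum_add_distrib, two_smul]
    congr 1
    rw [← Equiv.sum_comp (invCycleEquiv i)]
    exact sum_congr rfl fun σ _ => by simp [invCycleEquiv, sign_invCycle]
  apply smul_right_injective _ (two_ne_zero : (2 : C) ≠ 0)
  simp only []
  rw [double, double]
  refine sum_congr rfl fun σ _ => ?_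
  congr 1
  rw [cycleMins_invCycle]
  have hne : ∀ j ∈ cycleMins σ, i ∈ cycleMins σ → j ≠ i → ¬ σ.SameCycle i j := by
    intro j hj hi' hji h
    exact hji (le_antisymm (mem_cycleMins.1 hj i h.symm) (mem_cycleMins.1 hi' j h))
  by_cases him : i ∈ cycleMins σ
  · have e1 : (cycleMins σ).map (mooreFactor φ I hI A K (invCycle σ i)) =
        (cycleMins σ).map (fun j => if j = i then quatRep φ I hI (star (cycleProd A σ i))
          else mooreFactor φ I hI A K σ j) := by
      refine List.map_congr_left fun j hj => ?_
      by_cases hji : j = i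
      · subst hji; simp [mooreFactor, hi, cycleProd_invCycle_self A hA]
      · simp [mooreFactor, hji, cycleProd_invCycle_of_not_sameCycle A (hne j hj him hji)]
    have e2 : (cycleMins σ).map (mooreFactor φ I hI A (insert i K) (invCycle σ i)) =
        (cycleMins σ).map (fun j => if j = i then
          Matrix.scalar (Fin 2) (quatRep φ I hI (star (cycleProd A σ i)) 0 0)
          else mooreFactor φ I hI A K σ j) := by
      refine List.map_congr_left fun j hj => ?_
      by_cases hji : j = i
      · subst hji; simp [mooreFactor, cycleProd_invCycle_self A hA]
      · simp [mooreFactor, hji, cycleProd_invCycle_of_not_sameCycle A (hne j hj him hji)]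
    rw [e1, e2]
    refine list_prod_map_add_eq (i := i) ?_ ?_ ?_ ?_ (nodup_cycleMins σ) him
    · intro j hj; simp [hj, mooreFactor]
    · intro j hj; simp [hj, mooreFactor]
    · intro j hj; simp [hj, mooreFactor]
    · have := quatRep_add_star φ I hI (cycleProd A σ i)
      simpa [mooreFactor, hi] using this.symm
  -- If `i` is not a cycle minimum, no factor is indexed by it and enlarging `K` changes nothing.
  · have : ∀ τ, (cycleMins σ).map (mooreFactor φ I hI A (insert i K) τ) =
        (cycleMins σ).map (mooreFactor φ I hI A K τ) := fun τ =>
      List.map_congr_left fun j hj => by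
        have hji : j ≠ i := by rintro rfl; exact him hj
        simp [mooreFactor, hji]
    rw [this, this]

lemma quatRep_mooreSum [IsDomain C] [CharZero C] (hA : ∀ l k, star (A l k) = A k l) :
    quatRep φ I hI (mooreSum A) = Matrix.scalar (Fin 2)
      (∑ σ : Perm (Fin n), ((sign σ : ℤˣ) : ℤ) •
        ((cycleMins σ).map fun i => quatRep φ I hI (cycleProd A σ i) 0 0).prod) := by
  have key : ∀ K : Finset (Fin n), quatRep φ I hI (mooreSum A) =
      ∑ σ : Perm (Fin n), ((sign σ : ℤˣ) : ℤ) •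
        ((cycleMins σ).map (mooreFactor φ I hI A K σ)).prod := by
    intro K
    induction K using Finset.induction_on with
    | empty =>
      simp [mooreSum, mooreTerm_eq, mooreFactor_empty, map_sum, map_list_prod, Function.comp_def]
    | insert i K hi ih => rw [ih, mooreFactor_sum_insert φ I hI A hA K i hi]
  rw [key univ]
  simp only [mooreFactor_univ, map_sum, map_zsmul, map_list_prod, List.map_map,
    Function.comp_def]

/-- For a hyperhermitian matrix, the Moore determinant is a sum of products of scalars. -/
lemma mooreDet_eq_sum_cycleMins [IsDomain C] [CharZero C]
    (hA : ∀ l k, star (A l k) = A k l) :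
    φ (mooreDet A) = ∑ σ : Perm (Fin n), ((sign σ : ℤˣ) : ℤ) •
        ((cycleMins σ).map fun i => quatRep φ I hI (cycleProd A σ i) 0 0).prod := by
  -- The trace picks out twice the real part, which is how `mooreDet` is defined; on a scalar matrix
  -- it is twice the scalar.
  have h := quatRep_trace φ I hI (mooreSum A)
  rw [quatRep_mooreSum φ I hI A hA] at h
  simp only [Matrix.scalar_apply, Matrix.diagonal_apply_eq, ← two_mul] at h
  exact (mul_left_cancel₀ two_ne_zero h).symm

end moore

/-! ### Products along cycles as sums over index functions -/

lemma exists_mem_cycleMins {n : ℕ} (σ : Perm (Fin n)) (l : Fin n) :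
    ∃ i ∈ cycleMins σ, σ.SameCycle i l := by
  classical
  obtain ⟨i, hi, hmin⟩ := exists_min_image (univ.filter fun j => σ.SameCycle l j) id
    ⟨l, by simp [SameCycle.refl]⟩
  simp only [mem_filter, mem_univ, true_and, id_eq] at hi hmin
  exact ⟨i, mem_cycleMins.2 fun j hj => hmin j (hi.trans hj), hi.symm⟩

lemma minimalPeriod_perm_pos {n : ℕ} (σ : Perm (Fin n)) (i : Fin n) :
    0 < Function.minimalPeriod σ i :=
  Function.minimalPeriod_pos_of_mem_periodicPts
    (Function.Injective.mem_periodicPts σ.injective i)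

section path

variable {ι C : Type*} [Fintype ι] [DecidableEq ι] [CommRing C]

/-- Sum over paths. The start is imposed by a condition instead of being removed, so that there is
one free index per factor, hence one per element of a cycle. -/
lemma list_prod_matrix_apply_snoc (N : ℕ → Matrix ι ι C) (a b : ι) (p : ℕ) :
    ((List.range (p + 1)).map N).prod a b =
      ∑ s : Fin (p + 1) → ι, if s 0 = a then
        ∏ k : Fin (p + 1), N k (s k) ((Fin.snoc s b : Fin (p + 2) → ι) k.succ) else 0 := by
  induction p generalizing b with
  | zero =>
    rw [← (Equiv.funUnique (Fin 1) ι).symm.sum_comp]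
    simp [Fin.snoc]
  | succ p ih =>
    rw [List.range_succ, List.map_append, List.prod_append, Matrix.mul_apply,
      ← (Fin.snocEquiv fun _ : Fin (p + 2) => ι).sum_comp, Fintype.sum_prod_type]
    refine sum_congr rfl fun c _ => ?_
    rw [ih, sum_mul]
    refine sum_congr rfl fun s _ => ?_
    have h0 : (Fin.snoc s c : Fin (p + 2) → ι) 0 = s 0 :=
      Fin.snoc_castSucc (α := fun _ => ι) c s 0
    simp only [Fin.snocEquiv_apply, h0, ite_mul, zero_mul]
    congr 1
    rw [Fin.prod_univ_castSucc (n := p + 1)]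
    simp only [Fin.snoc_castSucc, Fin.succ_castSucc, Fin.snoc_last, Fin.succ_last]
    simp

lemma list_prod_matrix_apply (N : ℕ → Matrix ι ι C) (a b : ι) {p : ℕ} (hp : 0 < p) :
    ((List.range p).map N).prod a b =
      ∑ s : Fin p → ι, if s ⟨0, hp⟩ = a then
        ∏ k : Fin p, N k (s k) (if h : (k : ℕ) + 1 < p then s ⟨k + 1, h⟩ else b) else 0 := by
  obtain ⟨p, rfl⟩ := Nat.exists_eq_succ_of_ne_zero hp.ne'
  rw [list_prod_matrix_apply_snoc]
  refine sum_congr rfl fun s _ => ?_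
  congr 1

end path

/-- The elements of the cycles of `σ`, counted from the smallest element of each cycle. -/
def cycleEquiv {n : ℕ} (σ : Perm (Fin n)) :
    (Σ i : {i // i ∈ cycleMins σ}, Fin (Function.minimalPeriod σ i.1)) ≃ Fin n :=
  Equiv.ofBijective (fun x => (σ ^ (x.2 : ℕ)) x.1.1) <| by
    constructor
    · rintro ⟨⟨i, hi⟩, k⟩ ⟨⟨j, hj⟩, m⟩ h
      simp only at h
      have hij : σ.SameCycle i j := by
        have h1 : σ.SameCycle i ((σ ^ (k : ℕ)) i) := ⟨k, by simp⟩
        have h2 : σ.SameCycle j ((σ ^ (m : ℕ)) j) := ⟨m, by simp⟩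
        rw [h] at h1
        exact h1.trans h2.symm
      obtain rfl : i = j :=
        le_antisymm (mem_cycleMins.1 hi j hij) (mem_cycleMins.1 hj i hij.symm)
      rw [← iterate_eq_pow, ← iterate_eq_pow] at h
      have := Function.iterate_injOn_Iio_minimalPeriod (f := σ) (x := i) k.2 m.2 h
      rw [Fin.ext this]
    · intro l
      obtain ⟨i, hi, hil⟩ := exists_mem_cycleMins σ l
      obtain ⟨k, -, hk⟩ := hil.exists_pow_eq'
      refine ⟨⟨⟨i, hi⟩, ⟨k % Function.minimalPeriod σ i,
        Nat.mod_lt _ (minimalPeriod_perm_pos σ i)⟩⟩, ?_⟩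
      simp only
      rw [← iterate_eq_pow, Function.iterate_mod_minimalPeriod_eq, iterate_eq_pow, hk]

lemma cycleEquiv_apply {n : ℕ} (σ : Perm (Fin n))
    (x : Σ i : {i // i ∈ cycleMins σ}, Fin (Function.minimalPeriod σ i.1)) :
    cycleEquiv σ x = (σ ^ (x.2 : ℕ)) x.1.1 := rfl

/-- Each (0,0) entry is a sum over closed paths based at 0. The cycles partition `Fin n`, so a
choice of one path per cycle is a single index function, glued along `cycleEquiv`. -/
lemma prod_cycleMins_eq_sum {C : Type*} [CommRing C] {n : ℕ} (σ : Perm (Fin n))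
    (N : Fin n → Matrix (Fin 2) (Fin 2) C) :
    ((cycleMins σ).map fun i =>
        ((List.range (Function.minimalPeriod σ i)).map fun k => N ((σ ^ k) i)).prod 0 0).prod =
      ∑ s : Fin n → Fin 2, if ∀ i ∈ cycleMins σ, s i = 0 then
        ∏ l, N l (s l) (s (σ l)) else 0 := by
  classical
  rw [← List.prod_toFinset _ (nodup_cycleMins σ),
    Finset.prod_subtype (p := (· ∈ cycleMins σ)) _ (by simp)]
  have h1 := fun i : {i // i ∈ cycleMins σ} =>
    list_prod_matrix_apply (fun k => N ((σ ^ k) i.1)) 0 0 (minimalPeriod_perm_pos σ i.1)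
  simp only [h1]
  rw [Fintype.prod_sum, ← (((cycleEquiv σ).symm.arrowCongr (Equiv.refl (Fin 2))).trans
    (Equiv.piCurry fun _ _ => Fin 2)).sum_comp]
  refine sum_congr rfl fun s _ => ?_
  rw [Finset.prod_ite_zero]
  have hE : ∀ i k, (((cycleEquiv σ).symm.arrowCongr (Equiv.refl (Fin 2))).trans
    (Equiv.piCurry fun _ _ => Fin 2)) s i k = s ((σ ^ (k : ℕ)) i.1) := fun i k => rfl
  simp only [hE, pow_zero, one_apply, mem_univ, forall_const, Subtype.forall]
  split_ifs with hs
  · rw [← (cycleEquiv σ).prod_comp, Fintype.prod_sigma]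
    refine prod_congr rfl fun i _ => prod_congr rfl fun k _ => ?_
    rw [cycleEquiv_apply]
    congr 1
    split_ifs with hk
    · rw [pow_succ', mul_apply]
    -- The last factor returns to the minimum of the cycle, where the index is 0.
    · have : (k : ℕ) + 1 = Function.minimalPeriod σ i.1 := by
        have := k.2; omega
      rw [← mul_apply, ← pow_succ', this, pow_minimalPeriod_apply, hs i.1 i.2]
  · rfl

/-- The Moore determinant of a hyperhermitian matrix as a sum over permutations and index
functions. -/
lemma mooreDet_eq_sum {R C : Type*} [CommRing R] [CommRing C] (φ : R →+* C) (I : C)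
    (hI : I * I = -1) {n : ℕ} (A : Matrix (Fin n) (Fin n) (Quaternion R))
    [IsDomain C] [CharZero C] (hA : ∀ l k, star (A l k) = A k l) :
    φ (mooreDet A) = ∑ σ : Perm (Fin n), ∑ s : Fin n → Fin 2,
      if ∀ i ∈ cycleMins σ, s i = 0 then
        ((sign σ : ℤˣ) : ℤ) * ∏ l, quatRep φ I hI (A l (σ l)) (s l) (s (σ l)) else 0 := by
  rw [mooreDet_eq_sum_cycleMins φ I hI A hA]
  refine sum_congr rfl fun σ _ => ?_
  have := prod_cycleMins_eq_sum σ fun l => quatRep φ I hI (A l (σ l))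
  have h2 : ∀ i, quatRep φ I hI (cycleProd A σ i) =
      ((List.range (Function.minimalPeriod σ i)).map
        fun k => quatRep φ I hI (A ((σ ^ k) i) (σ ((σ ^ k) i)))).prod := by
    intro i
    simp only [cycleProd, map_list_prod, List.map_map, Function.comp_def, pow_succ', mul_apply]
  simp only [h2, this, zsmul_eq_mul, mul_sum, mul_ite, mul_zero]

/-! ### Permutations of `Fin n × Fin 2` and matchings -/

section pairing

variable {n : ℕ}

lemma fin_two_one_add (s : Fin 2) : 1 + s = 1 - s := by
  fin_cases s <;> rfl

lemma fin_two_eq_or (s t : Fin 2) : s = t ∨ s = 1 - t := by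
  revert s t; decide

lemma fin_two_ne_one_sub (s : Fin 2) : s ≠ 1 - s := by
  revert s; decide

/-- The involution `(l, s) ↦ (l, 1 - s)`. -/
def flipSnd (n : ℕ) : Perm (Fin n × Fin 2) := prodCongrRight fun _ => Equiv.subLeft 1

@[simp] lemma flipSnd_apply (l : Fin n) (s : Fin 2) : flipSnd n (l, s) = (l, 1 - s) := rfl

lemma flipSnd_flipSnd (x : Fin n × Fin 2) : flipSnd n (flipSnd n x) = x := by
  obtain ⟨l, s⟩ := x
  simp

lemma flipSnd_mul_self : flipSnd n * flipSnd n = 1 := by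
  ext1 x; exact flipSnd_flipSnd x

lemma flipSnd_ne (x : Fin n × Fin 2) : flipSnd n x ≠ x := by
  obtain ⟨l, s⟩ := x
  simp only [flipSnd_apply, ne_eq, Prod.mk.injEq, true_and]
  exact (fin_two_ne_one_sub s).symm

/-- The permutation `(l, t) ↦ (l, t + s l)`. -/
def twist (s : Fin n → Fin 2) : Perm (Fin n × Fin 2) := prodCongrRight fun l => Equiv.addRight (s l)

@[simp] lemma twist_apply (s : Fin n → Fin 2) (l : Fin n) (t : Fin 2) :
    twist s (l, t) = (l, t + s l) := rfl

lemma sign_twist (s : Fin n → Fin 2) : sign (twist s) = ∏ l, altSign ℤ (s l) := by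
  have h : ∀ a : Fin 2, ((sign (Equiv.addRight a) : ℤˣ) : ℤ) = altSign ℤ a := by
    unfold altSign; decide
  rw [twist, sign_prodCongrRight, Units.coe_prod]
  exact prod_congr rfl fun l _ => h (s l)

/-- The permutation with `(m, 0) ↦ (m, s m)` and `(m, 1) ↦ (σ m, 1 - s (σ m))`. -/
def pairPerm (σ : Perm (Fin n)) (s : Fin n → Fin 2) : Perm (Fin n × Fin 2) :=
  twist s * prodCongrLeft fun t => if t = 0 then 1 else σ

lemma pairPerm_zero (σ : Perm (Fin n)) (s : Fin n → Fin 2) (m : Fin n) :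
    pairPerm σ s (m, 0) = (m, s m) := by
  simp [pairPerm]

lemma pairPerm_one (σ : Perm (Fin n)) (s : Fin n → Fin 2) (m : Fin n) :
    pairPerm σ s (m, 1) = (σ m, 1 - s (σ m)) := by
  simp [pairPerm, fin_two_one_add]

lemma sign_pairPerm (σ : Perm (Fin n)) (s : Fin n → Fin 2) :
    ((sign (pairPerm σ s) : ℤˣ) : ℤ) = (∏ l, altSign ℤ (s l)) * (sign σ : ℤˣ) := by
  rw [pairPerm, Perm.sign_mul, Units.val_mul, sign_twist, sign_prodCongrLeft]
  simp

/-- The permutation `(m, t) ↦ (π m, t + e (π m))`. These are the permutations that commute with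
`flipSnd`. -/
def blockPerm (π : Perm (Fin n)) (e : Fin n → Fin 2) : Perm (Fin n × Fin 2) :=
  twist e * prodCongrLeft fun _ => π

@[simp] lemma blockPerm_apply (π : Perm (Fin n)) (e : Fin n → Fin 2) (m : Fin n) (t : Fin 2) :
    blockPerm π e (m, t) = (π m, t + e (π m)) := by
  simp [blockPerm]

/-- π acts on both sheets, so its sign enters squared. -/
lemma sign_blockPerm (π : Perm (Fin n)) (e : Fin n → Fin 2) :
    ((sign (blockPerm π e) : ℤˣ) : ℤ) = ∏ l, altSign ℤ (e l) := by
  rw [blockPerm, Perm.sign_mul, Units.val_mul, sign_twist, sign_prodCongrLeft]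
  simp

lemma blockPerm_mul_flipSnd (π : Perm (Fin n)) (e : Fin n → Fin 2) :
    blockPerm π e * flipSnd n = flipSnd n * blockPerm π e := by
  have h : ∀ s t : Fin 2, 1 - s + t = 1 - (s + t) := by decide
  ext1 ⟨m, t⟩
  simp [h]

lemma exists_eq_blockPerm {g : Perm (Fin n × Fin 2)} (hg : g * flipSnd n = flipSnd n * g) :
    ∃ π e, g = blockPerm π e := by
  have hg' : ∀ m, g (m, 1) = flipSnd n (g (m, 0)) := fun m => by
    simpa using Equiv.congr_fun hg (m, 0)
  have hinj : Function.Injective fun m => (g (m, 0)).1 := by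
    intro m m' h
    simp only at h
    rcases fin_two_eq_or (g (m, 0)).2 (g (m', 0)).2 with h2 | h2
    · exact congrArg Prod.fst (g.injective (Prod.ext h h2))
    · have : g (m, 0) = g (m', 1) := by
        rw [hg']; exact Prod.ext h h2
      exact congrArg Prod.fst (g.injective this)
  refine ⟨Equiv.ofBijective _ (Finite.injective_iff_bijective.1 hinj),
    fun l => (g ((Equiv.ofBijective _ (Finite.injective_iff_bijective.1 hinj)).symm l, 0)).2, ?_⟩
  ext1 ⟨m, t⟩
  rw [blockPerm_apply, Equiv.symm_apply_apply, Equiv.ofBijective_apply]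
  fin_cases t
  · simp
  · simp only [Fin.mk_one, fin_two_one_add]
    exact hg' m

/-! ### The orbits of a matching -/

/-- The composition of `flipSnd` with the matching `{w (m, 0), w (m, 1)}`. -/
def matchRot (w : Perm (Fin n × Fin 2)) : Perm (Fin n × Fin 2) :=
  flipSnd n * (w * flipSnd n * w⁻¹)

/-- `matchRot` sees only the matching of `w`, and the block permutations preserve the standard
matching. -/
lemma matchRot_mul_blockPerm (w : Perm (Fin n × Fin 2)) (π : Perm (Fin n)) (e : Fin n → Fin 2) :
    matchRot (w * blockPerm π e) = matchRot w := by
  rw [matchRot, matchRot, mul_inv_rev, mul_assoc w, blockPerm_mul_flipSnd]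
  group

lemma matchRot_pairPerm (σ : Perm (Fin n)) (s : Fin n → Fin 2) (l : Fin n) :
    matchRot (pairPerm σ s) (l, s l) = (σ l, s (σ l)) := by
  have : (pairPerm σ s)⁻¹ (l, s l) = (l, 0) := by
    rw [inv_eq_iff_eq, pairPerm_zero]
  rw [matchRot, mul_apply, mul_apply, mul_apply, this, flipSnd_apply l 0, sub_zero,
    pairPerm_one, flipSnd_apply, sub_sub_cancel]

/-- The dihedral relation: a product of two involutions is inverted under conjugation by either of
them. -/
lemma flipSnd_matchRot (w : Perm (Fin n × Fin 2)) :
    flipSnd n * matchRot w * flipSnd n = (matchRot w)⁻¹ := by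
  have h : (flipSnd n)⁻¹ = flipSnd n := inv_eq_of_mul_eq_one_left flipSnd_mul_self
  simp only [matchRot, mul_inv_rev, h, inv_inv, mul_assoc]
  rw [← mul_assoc (flipSnd n), flipSnd_mul_self, one_mul]

lemma flipSnd_matchRot_zpow (w : Perm (Fin n × Fin 2)) (k : ℤ) (x : Fin n × Fin 2) :
    (matchRot w ^ k) (flipSnd n x) = flipSnd n ((matchRot w ^ (-k)) x) := by
  have h : (flipSnd n)⁻¹ = flipSnd n := inv_eq_of_mul_eq_one_left flipSnd_mul_self
  have := conj_zpow (i := k) (a := flipSnd n) (b := matchRot w)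
  rw [h, flipSnd_matchRot, inv_zpow'] at this
  rw [this]
  simp [flipSnd_flipSnd]

lemma matchRot_ne_flipSnd (w : Perm (Fin n × Fin 2)) (x : Fin n × Fin 2) :
    matchRot w x ≠ flipSnd n x := by
  intro h
  have h1 := (flipSnd n).injective h
  rw [mul_apply, mul_apply, ← eq_inv_iff_eq] at h1
  exact flipSnd_ne _ h1

/-- The flip never sends a point into its own cycle, so cycles come in distinct pairs. Otherwise the
midpoint of the path from x to its flip would give a fixed point of `flipSnd` (even k) or of the
matching involution (odd k). -/
lemma matchRot_zpow_ne (w : Perm (Fin n × Fin 2)) (k : ℤ) (x : Fin n × Fin 2) :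
    (matchRot w ^ k) x ≠ flipSnd n x := by
  intro h
  rcases Int.even_or_odd' k with ⟨j, rfl | rfl⟩
  · refine flipSnd_ne ((matchRot w ^ j) x) ?_
    have h2 := congrArg (matchRot w ^ (-j)) h
    rw [← mul_apply, ← zpow_add, flipSnd_matchRot_zpow, neg_neg] at h2
    rw [← h2]
    congr 2; ring
  · refine matchRot_ne_flipSnd w ((matchRot w ^ j) x) ?_
    have h2 := congrArg (matchRot w ^ (-j)) h
    rw [← mul_apply, ← zpow_add, flipSnd_matchRot_zpow, neg_neg] at h2
    rw [← h2, ← mul_apply, ← zpow_one_add]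
    congr 2; ring

lemma sameCycle_matchRot_flipSnd {w : Perm (Fin n × Fin 2)} {x y : Fin n × Fin 2}
    (h : (matchRot w).SameCycle x y) :
    (matchRot w).SameCycle (flipSnd n x) (flipSnd n y) := by
  obtain ⟨k, rfl⟩ := h
  exact ⟨-k, by rw [flipSnd_matchRot_zpow, neg_neg]⟩

/-- Off the section l ↦ (l, s l), the dihedral relation expresses `matchRot` through its inverse on
the section, which `hs` makes computable. -/
lemma matchRot_ext {w w' : Perm (Fin n × Fin 2)} {s : Fin n → Fin 2}
    (h : ∀ l, matchRot w (l, s l) = matchRot w' (l, s l))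
    (hs : ∀ l, ∃ m, matchRot w (m, s m) = (l, s l)) : matchRot w = matchRot w' := by
  ext1 ⟨l, t⟩
  rcases fin_two_eq_or t (s l) with rfl | rfl
  · exact h l
  · obtain ⟨m, hm⟩ := hs l
    have e1 := flipSnd_matchRot_zpow w 1 (l, s l)
    have e2 := flipSnd_matchRot_zpow w' 1 (l, s l)
    rw [zpow_one, zpow_neg, zpow_one, flipSnd_apply] at e1 e2
    rw [e1, e2]
    congr 1
    have hm' := (h m).symm.trans hm
    rw [inv_eq_iff_eq.2 hm.symm, inv_eq_iff_eq.2 hm'.symm]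

lemma matchRot_pairPerm_pow (σ : Perm (Fin n)) (s : Fin n → Fin 2) (l : Fin n) (k : ℕ) :
    (matchRot (pairPerm σ s) ^ k) (l, s l) = ((σ ^ k) l, s ((σ ^ k) l)) := by
  induction k with
  | zero => rfl
  | succ k ih => rw [pow_succ', pow_succ', mul_apply, mul_apply, ih, matchRot_pairPerm]

lemma matchRot_pairPerm_zpow (σ : Perm (Fin n)) (s : Fin n → Fin 2) (l : Fin n) (k : ℤ) :
    (matchRot (pairPerm σ s) ^ k) (l, s l) = ((σ ^ k) l, s ((σ ^ k) l)) := by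
  cases k with
  | ofNat k => exact matchRot_pairPerm_pow σ s l k
  | negSucc k =>
    rw [zpow_negSucc, zpow_negSucc, inv_eq_iff_eq, matchRot_pairPerm_pow]
    simp

lemma sameCycle_of_matchRot_eq {σ σ' : Perm (Fin n)} {s s' : Fin n → Fin 2}
    (h : matchRot (pairPerm σ s) = matchRot (pairPerm σ' s')) {i j : Fin n}
    (hij : σ.SameCycle i j) : σ'.SameCycle i j := by
  obtain ⟨k, rfl⟩ := hij
  have h1 := matchRot_pairPerm_zpow σ s i k
  rcases fin_two_eq_or (s i) (s' i) with hs | hs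
  · rw [h, hs, matchRot_pairPerm_zpow] at h1
    exact ⟨k, congrArg Prod.fst h1⟩
  · rw [h, hs, ← flipSnd_apply, flipSnd_matchRot_zpow, matchRot_pairPerm_zpow] at h1
    exact ⟨-k, congrArg Prod.fst h1⟩

/-- The two permutations have the same cycles as sets, hence the same minima. Both sections pass
through (i, 0) at a minimum i, so they follow the same orbits. -/
lemma eq_of_matchRot_eq {σ σ' : Perm (Fin n)} {s s' : Fin n → Fin 2}
    (hs : ∀ i ∈ cycleMins σ, s i = 0) (hs' : ∀ i ∈ cycleMins σ', s' i = 0)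
    (h : matchRot (pairPerm σ s) = matchRot (pairPerm σ' s')) : σ = σ' ∧ s = s' := by
  have hss : s = s' := by
    funext l
    obtain ⟨i, hi, k, rfl⟩ := exists_mem_cycleMins σ l
    have hi' : i ∈ cycleMins σ' := mem_cycleMins.2 fun j hj =>
      mem_cycleMins.1 hi j (sameCycle_of_matchRot_eq h.symm hj)
    have h1 := matchRot_pairPerm_zpow σ s i k
    rw [h, hs i hi, ← hs' i hi', matchRot_pairPerm_zpow, Prod.mk.injEq] at h1
    rw [← h1.2, h1.1]
  subst hss
  refine ⟨?_, rfl⟩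
  ext1 l
  have h1 := matchRot_pairPerm σ s l
  rw [h, matchRot_pairPerm] at h1
  exact (congrArg Prod.fst h1).symm

/-- From each pair of cycles exchanged by the flip, keep the one through (i, 0) with i the least
index occurring. It meets each of its fibres exactly once: this defines s, and `matchRot w`
restricted to the kept cycles defines σ. -/
lemma exists_matchRot_eq (w : Perm (Fin n × Fin 2)) :
    ∃ (σ : Perm (Fin n)) (s : Fin n → Fin 2), (∀ i ∈ cycleMins σ, s i = 0) ∧
      matchRot (pairPerm σ s) = matchRot w := by
  classical
  have hflip : ∀ {l m : Fin n} {a b : Fin 2}, (matchRot w).SameCycle (l, a) (m, b) →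
      (matchRot w).SameCycle (l, 1 - a) (m, 1 - b) := fun h => sameCycle_matchRot_flipSnd h
  have hany : ∀ {l m : Fin n} {a b : Fin 2} (c : Fin 2),
      (matchRot w).SameCycle (l, a) (m, b) → ∃ d, (matchRot w).SameCycle (l, c) (m, d) := by
    intro l m a b c h
    rcases fin_two_eq_or c a with rfl | rfl
    · exact ⟨b, h⟩
    · exact ⟨_, hflip h⟩
  have hex : ∀ l, ∃ i : Fin n, ∃ s : Fin 2, (matchRot w).SameCycle (i, 0) (l, s) ∧
      ∀ j t, (matchRot w).SameCycle (i, 0) (j, t) → i ≤ j := by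
    intro l
    obtain ⟨i, hi, hmin⟩ := exists_min_image
      (univ.filter fun i => ∃ t, (matchRot w).SameCycle (l, 0) (i, t)) id
      ⟨l, mem_filter.2 ⟨mem_univ _, 0, SameCycle.refl _ _⟩⟩
    simp only [mem_filter, mem_univ, true_and, id_eq] at hi hmin
    obtain ⟨t, ht⟩ := hi
    obtain ⟨s, hs⟩ := hany 0 ht.symm
    refine ⟨i, s, hs, fun j t' hj => hmin j ?_⟩
    exact hany 0 (hs.symm.trans hj)
  choose i s hs hmin using hex
  have hi_le : ∀ {l m : Fin n} {a b : Fin 2}, (matchRot w).SameCycle (l, a) (m, b) →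
      i l ≤ i m := by
    intro l m a b h
    obtain ⟨c, hc⟩ := hany (s l) h
    obtain ⟨d, hd⟩ := hany c (hs m).symm
    exact hmin l _ d (((hs l).trans hc).trans hd)
  have hi_eq : ∀ {l m : Fin n} {a b : Fin 2}, (matchRot w).SameCycle (l, a) (m, b) →
      i l = i m := fun h => le_antisymm (hi_le h) (hi_le h.symm)
  have huniq : ∀ {l : Fin n} {a b : Fin 2}, (matchRot w).SameCycle (l, a) (l, b) → a = b := by
    rintro l a b ⟨k, hk⟩
    rcases fin_two_eq_or b a with rfl | rfl
    · rfl
    · exact absurd hk (matchRot_zpow_ne w k _)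
  -- The section is stable under `matchRot w`: the image stays in the kept cycle, and that cycle has
  -- only one point in each fibre.
  have hstep : ∀ l, matchRot w (l, s l) =
      ((matchRot w (l, s l)).1, s (matchRot w (l, s l)).1) := by
    intro l
    have h1 : (matchRot w).SameCycle (l, s l)
        ((matchRot w (l, s l)).1, (matchRot w (l, s l)).2) := ⟨1, by simp⟩
    have h2 := hs (matchRot w (l, s l)).1
    rw [← hi_eq h1] at h2
    exact Prod.ext rfl (huniq ((h1.symm.trans (hs l).symm).trans h2))
  have hinj : Function.Injective fun l => (matchRot w (l, s l)).1 := by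
    intro l m h
    simp only at h
    have : matchRot w (l, s l) = matchRot w (m, s m) := by rw [hstep l, hstep m, h]
    exact congrArg Prod.fst ((matchRot w).injective this)
  have hbij := Finite.injective_iff_bijective.1 hinj
  have hσ : ∀ l, matchRot w (l, s l) =
      (Equiv.ofBijective _ hbij l, s (Equiv.ofBijective _ hbij l)) := hstep
  generalize Equiv.ofBijective _ hbij = σ at hσ
  have heq : matchRot (pairPerm σ s) = matchRot w := by
    refine matchRot_ext (s := s) (fun l => ?_) fun l => ?_
    · rw [matchRot_pairPerm, hσ]
    · exact ⟨σ.symm l, by rw [matchRot_pairPerm, Equiv.apply_symm_apply]⟩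
  refine ⟨σ, s, fun l hl => ?_, heq⟩
  -- A σ-minimum l equals its own base index `i l`, so (l, s l) and (l, 0) lie in one cycle and s l
  -- = 0.
  have h1 : Perm.SameCycle σ l (i l) := by
    obtain ⟨k, hk⟩ := (hs l).symm
    rw [← heq, matchRot_pairPerm_zpow] at hk
    exact ⟨k, congrArg Prod.fst hk⟩
  have h2 : i l = l := le_antisymm (hmin l l _ (hs l)) (mem_cycleMins.1 hl _ h1)
  have h3 := hs l
  rw [h2] at h3
  exact (huniq h3).symm

/-! ### Decomposition of the permutations of `Fin n × Fin 2` -/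

/-- Every permutation of `Fin n × Fin 2` is in a unique way the product of a `pairPerm` with
normalized index function and a `blockPerm`. -/
lemma bijective_pairPerm_mul_blockPerm : Function.Bijective
    fun x : {p : Perm (Fin n) × (Fin n → Fin 2) // ∀ i ∈ cycleMins p.1, p.2 i = 0} ×
      (Perm (Fin n) × (Fin n → Fin 2)) => pairPerm x.1.1.1 x.1.1.2 * blockPerm x.2.1 x.2.2 := by
  constructor
  · rintro ⟨⟨⟨σ, s⟩, h⟩, π, e⟩ ⟨⟨⟨σ', s'⟩, h'⟩, π', e'⟩ heq
    simp only at heq h h'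
    have h1 := congrArg matchRot heq
    rw [matchRot_mul_blockPerm, matchRot_mul_blockPerm] at h1
    obtain ⟨rfl, rfl⟩ := eq_of_matchRot_eq h h' h1
    have h2 := mul_left_cancel heq
    have h3 : ∀ m, π m = π' m ∧ e (π m) = e' (π' m) := fun m => by
      simpa using Equiv.congr_fun h2 (m, 0)
    obtain rfl : π = π' := Equiv.ext fun m => (h3 m).1
    obtain rfl : e = e' := funext fun l => by
      simpa using (h3 (π.symm l)).2
    rfl
  · intro w
    obtain ⟨σ, s, hs, h⟩ := exists_matchRot_eq w
    have hc : ((pairPerm σ s)⁻¹ * w) * flipSnd n = flipSnd n * ((pairPerm σ s)⁻¹ * w) := by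
      have h1 := mul_left_cancel h
      have h2 : pairPerm σ s * flipSnd n = w * flipSnd n * w⁻¹ * pairPerm σ s := by
        rw [← h1]; group
      have h3 : flipSnd n = (pairPerm σ s)⁻¹ * (w * flipSnd n * w⁻¹ * pairPerm σ s) := by
        rw [← h2]; group
      conv_rhs => rw [h3]
      group
    obtain ⟨π, e, hπ⟩ := exists_eq_blockPerm hc
    exact ⟨⟨⟨(σ, s), hs⟩, π, e⟩, by simp only [← hπ]; group⟩

/-- The term of a permutation of `Fin n × Fin 2` in a Pfaffian-like sum, with one matrix for
each pair. -/
def pfTerm {C : Type*} [CommRing C] (P : Fin n → Fin n × Fin 2 → Fin n × Fin 2 → C)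
    (w : Perm (Fin n × Fin 2)) : C :=
  (((sign w : ℤˣ) : ℤ) : C) * ∏ m, P m (w (m, 0)) (w (m, 1))

/-- The sum of all terms `pfTerm`. -/
def pfSum {C : Type*} [CommRing C] (P : Fin n → Fin n × Fin 2 → Fin n × Fin 2 → C) : C :=
  ∑ w, pfTerm P w

lemma altSign_mul_self {C : Type*} [CommRing C] (s : Fin 2) : altSign C s * altSign C s = 1 := by
  fin_cases s <;> simp [altSign]

lemma intCast_altSign {C : Type*} [CommRing C] (s : Fin 2) :
    ((altSign ℤ s : ℤ) : C) = altSign C s := by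
  simp [altSign]

/-- Exchanging the entries of a pair changes both the sign of the permutation and one skew factor;
permuting whole pairs is even and only reorders the product, as all pairs use the same `P`. -/
lemma pfTerm_mul_blockPerm {C : Type*} [CommRing C] {P : Fin n × Fin 2 → Fin n × Fin 2 → C}
    (hP : ∀ x y, P y x = -P x y) (w : Perm (Fin n × Fin 2)) (π : Perm (Fin n))
    (e : Fin n → Fin 2) : pfTerm (fun _ => P) (w * blockPerm π e) = pfTerm (fun _ => P) w := by
  have h : ∀ m (a : Fin 2), P (w (m, 0 + a)) (w (m, 1 + a)) =
      altSign C a * P (w (m, 0)) (w (m, 1)) := by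
    intro m a
    fin_cases a
    · simp [altSign]
    · simpa [altSign] using hP _ _
  simp only [pfTerm, mul_apply, blockPerm_apply, h]
  rw [Perm.sign_mul, Units.val_mul, Int.cast_mul, sign_blockPerm, Int.cast_prod,
    Equiv.prod_comp π (fun m => altSign C (e m) * P (w (m, 0)) (w (m, 1))), prod_mul_distrib, mul_assoc,
    ← mul_assoc (∏ l, _), ← prod_mul_distrib]
  simp [intCast_altSign, altSign_mul_self]

end pairing

/-! ### Second order derivatives -/

section analysis

variable {n : ℕ} {E : Type*} [NormedAddCommGroup E] [NormedSpace ℝ E]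

lemma differentiable_partialX {u : (Fin n → Quaternion ℝ) → ℝ} (hu : ContDiff ℝ 2 u) (k : Fin n)
    (b : Fin 4) : Differentiable ℝ (partialX k b u) :=
  ((hu.fderiv_right (m := 1) (by norm_num)).clm_apply contDiff_const).differentiable
    one_ne_zero

lemma partialX_partialX_comm {u : (Fin n → Quaternion ℝ) → ℝ} (hu : ContDiff ℝ 2 u)
    (l k : Fin n) (a b : Fin 4) (q : Fin n → Quaternion ℝ) :
    partialX l a (partialX k b u) q = partialX k b (partialX l a u) q := by
  have hd : DifferentiableAt ℝ (fderiv ℝ u) q :=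
    ((hu.fderiv_right (m := 1) (by norm_num)).differentiable one_ne_zero) q
  have h : ∀ v w : Fin n → Quaternion ℝ,
      fderiv ℝ (fun p => fderiv ℝ u p v) q w = fderiv ℝ (fderiv ℝ u) q w v := by
    intro v w
    rw [fderiv_clm_apply hd (differentiableAt_const v)]
    simp
  have hs : IsSymmSndFDerivAt ℝ u q :=
    hu.contDiffAt.isSymmSndFDerivAt (by simp)
  change fderiv ℝ (fun p => fderiv ℝ u p _) q _ = fderiv ℝ (fun p => fderiv ℝ u p _) q _
  rw [h, h]
  exact hs _ _

lemma partialX_smul_const {g : (Fin n → Quaternion ℝ) → ℝ} (hg : Differentiable ℝ g) (l : Fin n)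
    (a : Fin 4) (z : E) (q : Fin n → Quaternion ℝ) :
    partialX l a (fun p => g p • z) q = partialX l a g q • z := by
  rw [partialX, fderiv_smul_const (hg q)]
  rfl

lemma partialX_sum_smul_const {g : Fin 4 → (Fin n → Quaternion ℝ) → ℝ}
    (hg : ∀ b, Differentiable ℝ (g b)) (l : Fin n) (a : Fin 4) (z : Fin 4 → E)
    (q : Fin n → Quaternion ℝ) :
    partialX l a (fun p => ∑ b, g b p • z b) q = ∑ b, partialX l a (g b) q • z b := by
  rw [partialX, fderiv_fun_sum fun b _ => ((hg b) q).smul_const (z b),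
    _root_.sum_apply]
  exact sum_congr rfl fun b _ => partialX_smul_const (hg b) l a (z b) q

lemma partialX_ofReal {g : (Fin n → Quaternion ℝ) → ℝ} (hg : Differentiable ℝ g) (l : Fin n)
    (a : Fin 4) (q : Fin n → Quaternion ℝ) :
    partialX l a (fun p => (g p : ℂ)) q = partialX l a g q := by
  simpa using partialX_smul_const hg l a (1 : ℂ) q

lemma partialX_coe_quaternion {g : (Fin n → Quaternion ℝ) → ℝ} (hg : Differentiable ℝ g)
    (l : Fin n) (a : Fin 4) (q : Fin n → Quaternion ℝ) :
    partialX l a (fun p => (g p : Quaternion ℝ)) q = ((partialX l a g q : ℝ) : Quaternion ℝ) := by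
  have h : ∀ r : ℝ, (r : Quaternion ℝ) = r • (1 : Quaternion ℝ) := fun r => by
    rw [← Quaternion.coe_mul_eq_smul, mul_one]
  simp only [h]
  exact partialX_smul_const hg l a 1 q

/-- The coefficients of the operators `∇_{jα}`. -/
def nablaCoef (s α : Fin 2) (a : Fin 4) : ℂ :=
  quatRep Complex.ofRealHom Complex.I Complex.I_mul_I (unit a) s α

lemma nabla_eq_sum (l : Fin n) (s α : Fin 2) (F : (Fin n → Quaternion ℝ) → ℂ)
    (q : Fin n → Quaternion ℝ) :
    nabla (l, s) α F q = ∑ a, nablaCoef s α a * partialX l a F q := by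
  fin_cases s <;> fin_cases α <;>
    simp [nabla, nablaCoef, Fin.sum_univ_four, quatRep_apply, unit, sub_eq_add_neg]

lemma nabla_nabla_eq_sum {u : (Fin n → Quaternion ℝ) → ℝ} (hu : ContDiff ℝ 2 u) (l k : Fin n)
    (s t α β : Fin 2) (q : Fin n → Quaternion ℝ) :
    nabla (l, s) α (nabla (k, t) β (fun p => (u p : ℂ))) q =
      ∑ a, ∑ b, nablaCoef s α a * nablaCoef t β b * (partialX l a (partialX k b u) q : ℝ) := by
  have h : nabla (k, t) β (fun p => (u p : ℂ)) =
      fun p => ∑ b, partialX k b u p • nablaCoef t β b := by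
    funext p
    rw [nabla_eq_sum]
    refine sum_congr rfl fun b _ => ?_
    rw [partialX_ofReal (hu.differentiable two_ne_zero), Complex.real_smul, mul_comm]
  rw [h, nabla_eq_sum]
  refine sum_congr rfl fun a _ => ?_
  rw [partialX_sum_smul_const fun b => differentiable_partialX hu k b, mul_sum]
  refine sum_congr rfl fun b _ => ?_
  rw [Complex.real_smul]
  ring

lemma hessian_eq_sum {u : (Fin n → Quaternion ℝ) → ℝ} (hu : ContDiff ℝ 2 u) (l k : Fin n)
    (q : Fin n → Quaternion ℝ) :
    hessian u q l k =
      ∑ a, ∑ b, partialX l a (partialX k b u) q • (unit a * star (unit b)) := by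
  have h : dq k (fun p => (u p : Quaternion ℝ)) =
      fun p => ∑ b, partialX k b u p • star (unit b) := by
    funext p
    refine sum_congr rfl fun b _ => ?_
    rw [partialX_coe_quaternion (hu.differentiable two_ne_zero), Quaternion.mul_coe_eq_smul]
  rw [hessian, Matrix.of_apply, dqBar, h]
  refine sum_congr rfl fun a _ => ?_
  rw [partialX_sum_smul_const fun b => differentiable_partialX hu k b, mul_sum]
  exact sum_congr rfl fun b _ => mul_smul_comm (partialX l a (partialX k b u) q) (unit a) (star (unit b))

lemma star_hessian {u : (Fin n → Quaternion ℝ) → ℝ} (hu : ContDiff ℝ 2 u)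
    (q : Fin n → Quaternion ℝ) (l k : Fin n) : star (hessian u q l k) = hessian u q k l := by
  rw [hessian_eq_sum hu, hessian_eq_sum hu, sum_comm]
  simp only [star_sum]
  refine sum_congr rfl fun b _ => sum_congr rfl fun a _ => ?_
  rw [Quaternion.star_smul, star_mul, star_star, partialX_partialX_comm hu]

/-- Constant-coefficient operators commute on C² functions, so ∇_{i1}∇_{j0}u = ∇_{j0}∇_{i1}u. -/
lemma triangle_eq_nabla2_sub {u : (Fin n → Quaternion ℝ) → ℝ} (hu : ContDiff ℝ 2 u)
    (i j : Fin n × Fin 2) (q : Fin n → Quaternion ℝ) :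
    triangle i j u q = (nabla2 i j u q - nabla2 j i u q) / 2 := by
  obtain ⟨l, s⟩ := i
  obtain ⟨k, t⟩ := j
  rw [triangle, nabla2, nabla2]
  congr 2
  rw [nabla_nabla_eq_sum hu, nabla_nabla_eq_sum hu, sum_comm]
  refine sum_congr rfl fun b _ => sum_congr rfl fun a _ => ?_
  rw [partialX_partialX_comm hu]
  ring

/-- The pairing of `Fin n × Fin 2` with itself associated to a quaternionic matrix. -/
def quatPair {R C : Type*} [CommRing R] [CommRing C] (φ : R →+* C) (I : C) (hI : I * I = -1)
    (A : Matrix (Fin n) (Fin n) (Quaternion R)) (x y : Fin n × Fin 2) : C :=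
  altSign C (1 - y.2) * quatRep φ I hI (A x.1 y.1) x.2 (1 - y.2)

/-- ∂/∂q̄_l is represented by the l-th block of ∇ and ∂/∂q_k by the adjugate of the k-th; an entry
of their product is, up to sign, a 2×2 minor in the operators ∇. -/
lemma quatPair_hessian {u : (Fin n → Quaternion ℝ) → ℝ} (hu : ContDiff ℝ 2 u)
    (i j : Fin n × Fin 2) (q : Fin n → Quaternion ℝ) :
    quatPair Complex.ofRealHom Complex.I Complex.I_mul_I (hessian u q) i j =
      2 * triangle i j u q := by
  obtain ⟨l, s⟩ := i
  obtain ⟨k, t⟩ := j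
  have hsmul : ∀ (r : ℝ) (x : Quaternion ℝ) (s t : Fin 2),
      quatRep Complex.ofRealHom Complex.I Complex.I_mul_I (r • x) s t =
        r * quatRep Complex.ofRealHom Complex.I Complex.I_mul_I x s t := by
    intro r x s t
    fin_cases s <;> fin_cases t <;> simp [quatRep_apply] <;> ring
  rw [triangle, nabla_nabla_eq_sum hu, nabla_nabla_eq_sum hu, mul_div_cancel₀ _ two_ne_zero,
    quatPair, hessian_eq_sum hu]
  simp only [map_sum, Matrix.sum_apply, hsmul, map_mul, Matrix.mul_apply, Fin.sum_univ_two,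
    quatRep_star, mul_sum, ← sum_sub_distrib, nablaCoef]
  refine sum_congr rfl fun a _ => sum_congr rfl fun b _ => ?_
  fin_cases t <;> simp [altSign] <;> ring

end analysis

/-! ### The Moore determinant as a sum over permutations of `Fin n × Fin 2` -/

section pfaffian

variable {n : ℕ}

lemma quatPair_skew {R C : Type*} [CommRing R] [CommRing C] (φ : R →+* C) (I : C)
    (hI : I * I = -1) {A : Matrix (Fin n) (Fin n) (Quaternion R)}
    (hA : ∀ l k, star (A l k) = A k l) (x y : Fin n × Fin 2) :
    quatPair φ I hI A y x = -quatPair φ I hI A x y := by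
  obtain ⟨l, s⟩ := x
  obtain ⟨k, t⟩ := y
  rw [quatPair, quatPair, ← hA l k, quatRep_star, sub_sub_cancel]
  fin_cases s <;> fin_cases t <;> simp [altSign]

lemma pfTerm_pairPerm {R C : Type*} [CommRing R] [CommRing C] (φ : R →+* C) (I : C)
    (hI : I * I = -1) (A : Matrix (Fin n) (Fin n) (Quaternion R)) (σ : Perm (Fin n))
    (s : Fin n → Fin 2) :
    pfTerm (fun _ => quatPair φ I hI A) (pairPerm σ s) =
      ((sign σ : ℤˣ) : ℤ) * ∏ l, quatRep φ I hI (A l (σ l)) (s l) (s (σ l)) := by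
  simp only [pfTerm, pairPerm_zero, pairPerm_one, quatPair, sub_sub_cancel, prod_mul_distrib]
  rw [sign_pairPerm, Equiv.prod_comp σ fun l => altSign C (s l)]
  push_cast
  simp only [intCast_altSign]
  -- One product of signs comes from `sign_pairPerm`, the other from `quatPair` after reindexing by
  -- σ.
  have h : (∏ l, altSign C (s l)) * ∏ l, altSign C (s l) = 1 := by
    rw [← prod_mul_distrib]
    exact prod_eq_one fun l _ => altSign_mul_self _
  linear_combination ((((sign σ : ℤˣ) : ℤ) : C) *
    ∏ l, quatRep φ I hI (A l (σ l)) (s l) (s (σ l))) * h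

/-- The Moore determinant of a hyperhermitian matrix as a Pfaffian. -/
theorem pfSum_quatPair {R C : Type*} [CommRing R] [CommRing C] [IsDomain C] [CharZero C]
    (φ : R →+* C) (I : C) (hI : I * I = -1) {A : Matrix (Fin n) (Fin n) (Quaternion R)}
    (hA : ∀ l k, star (A l k) = A k l) :
    pfSum (fun _ => quatPair φ I hI A) = 2 ^ n * n.factorial * φ (mooreDet A) := by
  classical
  rw [pfSum, ← bijective_pairPerm_mul_blockPerm.sum_comp, Fintype.sum_prod_type]
  -- Terms are constant along the block factor, whose `n! * 2 ^ n` values produce the constant.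
  simp only [pfTerm_mul_blockPerm (quatPair_skew φ I hI hA), sum_const, card_univ,
    Fintype.card_prod, Fintype.card_perm, Fintype.card_fun, Fintype.card_fin, nsmul_eq_mul,
    pfTerm_pairPerm, ← mul_sum]
  rw [mooreDet_eq_sum φ I hI A hA, ← Fintype.sum_prod_type', ← sum_filter,
    ← Finset.sum_subtype_eq_sum_filter]
  simp only [subtype_univ]
  push_cast
  ring

/-- Replacing each matrix by its antisymmetrization. -/
lemma pfSum_sub_swap {C : Type*} [CommRing C]
    (Q : Fin n → Fin n × Fin 2 → Fin n × Fin 2 → C) :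
    pfSum (fun m x y => Q m x y - Q m y x) = 2 ^ n * pfSum Q := by
  have h : ∀ w, pfTerm (fun m x y => Q m x y - Q m y x) w =
      ∑ e : Fin n → Fin 2, pfTerm Q (w * twist e) := by
    intro w
    have h1 : ∀ m, Q m (w (m, 0)) (w (m, 1)) - Q m (w (m, 1)) (w (m, 0)) =
        ∑ a : Fin 2, altSign C a * Q m (w (m, 0 + a)) (w (m, 1 + a)) := by
      intro m
      simp [altSign, sub_eq_add_neg]
    simp only [pfTerm, h1, Fintype.prod_sum, mul_sum, mul_apply, twist_apply, prod_mul_distrib]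
    refine sum_congr rfl fun e _ => ?_
    rw [Perm.sign_mul, Units.val_mul, sign_twist]
    push_cast
    simp only [intCast_altSign]
    ring
  simp only [pfSum, h]
  rw [sum_comm]
  have h2 : ∀ e : Fin n → Fin 2, ∑ w, pfTerm Q (w * twist e) = ∑ w, pfTerm Q w := fun e =>
    Equiv.sum_comp (Equiv.mulRight (twist e)) (pfTerm Q)
  simp [h2]

lemma pfSum_const_mul {C : Type*} [CommRing C] (c : C)
    (Q : Fin n → Fin n × Fin 2 → Fin n × Fin 2 → C) :
    pfSum (fun m x y => c * Q m x y) = c ^ n * pfSum Q := by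
  simp only [pfSum, pfTerm, prod_mul_distrib, prod_const, card_univ, Fintype.card_fin, mul_sum]
  exact sum_congr rfl fun w _ => by ring

open Classical in
lemma sum_ite_bijective {α M : Type*} [Fintype α] [DecidableEq α] [AddCommMonoid M]
    (F : (α → α) → M) :
    ∑ g : α → α, (if Function.Bijective g then F g else 0) = ∑ π : Perm α, F π := by
  symm
  refine Fintype.sum_of_injective (fun π : Perm α => (π : α → α)) DFunLike.coe_injective _ _ ?_ ?_
  · intro g hg
    rw [if_neg]
    exact fun h => hg ⟨Equiv.ofBijective g h, rfl⟩
  · intro π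
    rw [if_pos π.bijective]

lemma sum_delta_mul (P : Fin n → Fin n × Fin 2 → Fin n × Fin 2 → ℂ) :
    ∑ w : Fin n × Fin 2 → Fin n × Fin 2, delta w * ∏ m, P m (w (m, 0)) (w (m, 1)) =
      pfSum P := by
  classical
  symm
  refine Fintype.sum_of_injective (fun π : Perm (Fin n × Fin 2) => (π : _ → _))
    DFunLike.coe_injective _ _ ?_ ?_
  · intro g hg
    rw [delta, dif_neg, zero_mul]
    exact fun h => hg ⟨Equiv.ofBijective g h, rfl⟩
  · intro π
    have : Equiv.ofBijective π π.bijective = π := by ext1; rfl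
    rw [delta, dif_pos π.bijective, this, pfTerm]

/-! ### The coefficient of `λ_1 ⋯ λ_n` -/

lemma sum_single_eq_iff {g : Fin n → Fin n} :
    (∑ m, Finsupp.single (g m) 1 : Fin n →₀ ℕ) = ∑ m, Finsupp.single m 1 ↔
      Function.Bijective g := by
  classical
  constructor
  · intro h
    refine Finite.surjective_iff_bijective.1 fun j => ?_
    have hj := DFunLike.congr_fun h j
    simp only [Finsupp.finsetSum_apply, Finsupp.single_apply, sum_ite_eq', mem_univ,
      if_true] at hj
    by_contra hne
    push Not at hne
    simp [hne] at hj
  · intro h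
    exact h.sum_comp fun m => Finsupp.single m 1

lemma coeff_prod_sum_X_mul_C {S : Type*} [CommRing S] (c : Fin n → Fin n → S) :
    MvPolynomial.coeff (∑ m : Fin n, Finsupp.single m 1)
        (∏ m, ∑ j, (MvPolynomial.X j * MvPolynomial.C (c m j) : MvPolynomial (Fin n) S)) =
      ∑ π : Perm (Fin n), ∏ m, c m (π m) := by
  classical
  have h : ∀ g : Fin n → Fin n,
      ∏ m, (MvPolynomial.X (g m) * MvPolynomial.C (c m (g m)) : MvPolynomial (Fin n) S) =
        MvPolynomial.monomial (∑ m, Finsupp.single (g m) 1) (∏ m, c m (g m)) := by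
    intro g
    rw [prod_mul_distrib, ← map_prod, mul_comm, ← mul_one (∏ m, c m (g m)),
      ← MvPolynomial.C_mul_monomial, MvPolynomial.monomial_sum_one, mul_one]
    rfl
  simp only [Fintype.prod_sum, h, MvPolynomial.coeff_sum, MvPolynomial.coeff_monomial,
    sum_single_eq_iff]
  exact sum_ite_bijective fun g => ∏ m, c m (g m)

/-- The coefficient sums over all assignments π of the n forms to the n pairs. Each π is absorbed by
permuting the pairs, an even permutation, which leaves n! equal sums. -/
lemma coeff_pfSum {S : Type*} [CommRing S] (P : Fin n → Fin n × Fin 2 → Fin n × Fin 2 → S) :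
    MvPolynomial.coeff (∑ m : Fin n, Finsupp.single m 1)
        (pfSum fun _ x y => ∑ j, (MvPolynomial.X j * MvPolynomial.C (P j x y) :
          MvPolynomial (Fin n) S)) = n.factorial * pfSum P := by
  have h : ∀ w (π : Perm (Fin n)), (((sign w : ℤˣ) : ℤ) : S) *
      ∏ m, P (π m) (w (m, 0)) (w (m, 1)) = pfTerm P (w * blockPerm π⁻¹ 0) := by
    intro w π
    rw [pfTerm, Perm.sign_mul, Units.val_mul, sign_blockPerm,
      ← Equiv.prod_comp π fun m => P m _ _]
    simp [altSign]
  have h1 : ∀ k : ℤ, (k : MvPolynomial (Fin n) S) = MvPolynomial.C (k : S) := fun k => by simp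
  simp only [pfSum, pfTerm, MvPolynomial.coeff_sum, h1, MvPolynomial.coeff_C_mul]
  have h2 := fun w : Perm (Fin n × Fin 2) =>
    coeff_prod_sum_X_mul_C fun m j => P j (w (m, 0)) (w (m, 1))
  simp only [h2, mul_sum, h]
  rw [sum_comm]
  have h3 : ∀ π : Perm (Fin n), ∑ w, pfTerm P (w * blockPerm π⁻¹ 0) = ∑ w, pfTerm P w :=
    fun π => Equiv.sum_comp (Equiv.mulRight (blockPerm π⁻¹ 0)) (pfTerm P)
  simp only [h3, sum_const, card_univ, Fintype.card_perm, Fintype.card_fin, nsmul_eq_mul]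
  rw [mul_sum]
  rfl

end pfaffian

/-! ### Mixed discriminants -/

section mixed

variable {n : ℕ}

lemma star_sum_quaternion {R ι : Type*} [CommRing R] (s : Finset ι) (F : ι → Quaternion R) :
    star (∑ m ∈ s, F m) = ∑ m ∈ s, star (F m) := star_sum _ _

lemma constPoly_re (x : Quaternion ℝ) : (constPoly (n := n) x).re = MvPolynomial.C x.re := rfl

lemma constPoly_imI (x : Quaternion ℝ) : (constPoly (n := n) x).imI = MvPolynomial.C x.imI := rfl

lemma constPoly_imJ (x : Quaternion ℝ) : (constPoly (n := n) x).imJ = MvPolynomial.C x.imJ := rfl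

lemma constPoly_imK (x : Quaternion ℝ) : (constPoly (n := n) x).imK = MvPolynomial.C x.imK := rfl

lemma star_constPoly (x : Quaternion ℝ) :
    star (constPoly (n := n) x) = constPoly (star x) := by
  apply Quaternion.ext <;> simp [constPoly_re, constPoly_imI, constPoly_imJ, constPoly_imK]

lemma pfSum_mixed {A : Fin n → Matrix (Fin n) (Fin n) (Quaternion ℝ)}
    (hA : ∀ m l k, star (A m l k) = A m k l) :
    pfSum (fun m => quatPair Complex.ofRealHom Complex.I Complex.I_mul_I (A m)) =
      2 ^ n * (n.factorial * (mixedDiscriminant A : ℂ)) := by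
  have hI : (MvPolynomial.C Complex.I : MvPolynomial (Fin n) ℂ) * MvPolynomial.C Complex.I =
      -1 := by
    rw [← map_mul, Complex.I_mul_I, map_neg, map_one]
  have hsum : ∀ l k, (∑ m : Fin n, (MvPolynomial.X m : MvPolynomial (Fin n) ℝ) •
      (A m).map (constPoly (n := n))) l k =
        ∑ m, (MvPolynomial.X m : MvPolynomial (Fin n) ℝ) • constPoly (A m l k) := by
    intro l k
    rw [Matrix.sum_apply]
    rfl
  have hherm : ∀ l k, star ((∑ m : Fin n, (MvPolynomial.X m : MvPolynomial (Fin n) ℝ) •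
      (A m).map (constPoly (n := n))) l k) =
        (∑ m : Fin n, (MvPolynomial.X m : MvPolynomial (Fin n) ℝ) •
          (A m).map (constPoly (n := n))) k l := by
    intro l k
    rw [hsum, hsum]
    refine (star_sum_quaternion _ _).trans (sum_congr rfl fun m _ => ?_)
    rw [Quaternion.star_smul, star_constPoly, hA]
  -- Polarization: the Pfaffian identity for the generic combination, with polynomial coefficients.
  have key := pfSum_quatPair (MvPolynomial.map Complex.ofRealHom) (MvPolynomial.C Complex.I) hI
    hherm
  have hrep : ∀ (x : Quaternion ℝ) (m : Fin n) (s t : Fin 2),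
      quatRep (MvPolynomial.map Complex.ofRealHom) (MvPolynomial.C Complex.I) hI
        ((MvPolynomial.X m : MvPolynomial (Fin n) ℝ) • constPoly x) s t =
      MvPolynomial.X m * MvPolynomial.C
        (quatRep Complex.ofRealHom Complex.I Complex.I_mul_I x s t) := by
    intro x m s t
    fin_cases s <;> fin_cases t <;>
      simp [quatRep_apply, constPoly_re, constPoly_imI, constPoly_imJ, constPoly_imK] <;> ring
  have hpair : quatPair (MvPolynomial.map Complex.ofRealHom) (MvPolynomial.C Complex.I) hI
      (∑ m : Fin n, (MvPolynomial.X m : MvPolynomial (Fin n) ℝ) •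
        (A m).map (constPoly (n := n))) =
      fun x y => ∑ m, MvPolynomial.X m * MvPolynomial.C
        (quatPair Complex.ofRealHom Complex.I Complex.I_mul_I (A m) x y) := by
    funext x y
    rw [quatPair, hsum, map_sum, Matrix.sum_apply, mul_sum]
    refine sum_congr rfl fun m _ => ?_
    rw [hrep, quatPair, map_mul, mul_left_comm]
    simp [altSign]
  have hc := congrArg (MvPolynomial.coeff (∑ m : Fin n, Finsupp.single m 1)) key
  rw [hpair, coeff_pfSum] at hc
  have hnum : (2 ^ n * n.factorial : MvPolynomial (Fin n) ℂ) =
      MvPolynomial.C ((2 : ℂ) ^ n * (n.factorial : ℂ)) := by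
    rw [map_mul, map_pow, map_natCast, map_ofNat]
  rw [hnum, MvPolynomial.coeff_C_mul, MvPolynomial.coeff_map] at hc
  -- The n! from `coeff_pfSum` cancels the one from `pfSum_quatPair`; the n! in the result undoes
  -- the division in `mixedDiscriminant`.
  have hf : (n.factorial : ℂ) ≠ 0 := by exact_mod_cast n.factorial_ne_zero
  apply mul_left_cancel₀ hf
  rw [hc, mixedDiscriminant]
  push_cast
  rw [mul_div_cancel₀ _ hf]
  simp only [Complex.ofRealHom_eq_coe, detPoly]
  ring

lemma bastonMixed_eq {f : Fin n → (Fin n → Quaternion ℝ) → ℝ} (hf : ∀ i, ContDiff ℝ 2 (f i))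
    (q : Fin n → Quaternion ℝ) :
    2 ^ n * bastonMixed f q = pfSum fun m =>
      quatPair Complex.ofRealHom Complex.I Complex.I_mul_I (hessian (f m) q) := by
  rw [bastonMixed, sum_delta_mul fun m x y => triangle x y (f m) q, ← pfSum_const_mul]
  congr 1
  funext m x y
  rw [quatPair_hessian (hf m)]

lemma bastonMixed_eq_baston {u : (Fin n → Quaternion ℝ) → ℝ} (hu : ContDiff ℝ 2 u)
    (q : Fin n → Quaternion ℝ) : bastonMixed (fun _ => u) q = baston u q := by
  have h2 : (2 ^ n : ℂ) ≠ 0 := pow_ne_zero _ two_ne_zero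
  apply mul_left_cancel₀ h2
  rw [bastonMixed, sum_delta_mul fun _ x y => triangle x y u q, ← pfSum_const_mul, baston,
    sum_delta_mul fun _ x y => nabla2 x y u q, ← pfSum_sub_swap]
  congr 1
  funext m x y
  rw [triangle_eq_nabla2_sub hu, mul_div_cancel₀ _ two_ne_zero]

end mixed

end

end QuatMA

theorem theoremA1 (n : ℕ) :
    (∀ f : Fin n → (Fin n → Quaternion ℝ) → ℝ, (∀ i, ContDiff ℝ 2 (f i)) →
      ∀ q : Fin n → Quaternion ℝ,
        QuatMA.bastonMixed f q =
          (((n.factorial : ℝ) *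
            QuatMA.mixedDiscriminant (fun i => QuatMA.hessian (f i) q) : ℝ) : ℂ)) ∧
    (∀ u : (Fin n → Quaternion ℝ) → ℝ, ContDiff ℝ 2 u →
      ∀ q : Fin n → Quaternion ℝ,
        QuatMA.bastonMixed (fun _ => u) q = QuatMA.baston u q ∧
        QuatMA.baston u q =
          (((n.factorial : ℝ) * QuatMA.mooreDet (QuatMA.hessian u q) : ℝ) : ℂ)) := by
  have h2 : (2 ^ n : ℂ) ≠ 0 := pow_ne_zero _ two_ne_zero
  refine ⟨fun f hf q => ?_, fun u hu q => ⟨QuatMA.bastonMixed_eq_baston hu q, ?_⟩⟩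
  · apply mul_left_cancel₀ h2
    rw [QuatMA.bastonMixed_eq hf, QuatMA.pfSum_mixed fun m => QuatMA.star_hessian (hf m) q]
    push_cast
    rfl
  · apply mul_left_cancel₀ h2
    -- For equal arguments the Pfaffian identity applies directly to the Hessian, without the mixed
    -- discriminant.
    rw [← QuatMA.bastonMixed_eq_baston hu, QuatMA.bastonMixed_eq fun _ => hu,
      QuatMA.pfSum_quatPair _ _ _ (QuatMA.star_hessian hu q)]
    push_cast
    rw [mul_assoc]
    rfl
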